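/- Let $\nu\ge 1$, $[\nu]=\{1,\dots,\nu\}$, let $e_i$ be the $i$-th unit vector of $\mathbb Z^\nu$, and for $m\in\mathbb Z^\nu$ put $|m|=m_1+\cdots+m_\nu$, $z^m=\prod_j z_j^{m_j}$, $q^m=\prod_j q_j^{m_j}$. Let $q\in(\mathbb C^*)^\nu$ be non-resonant: $q_i\ne q^m$ for all $i\in[\nu]$ and $m\in\mathbb N^\nu$ with $|m|\ge2$. Let $R_q(z)=(q_1z_1,\dots,q_\nu z_\nu)$, let $a=(a_1,\dots,a_\nu)$ be a $\nu$-tuple of formal series in $\mathbb C[[z_1,\dots,z_\nu]]$ of total order $\ge2$, and let $g=R_q\circ(\mathrm{id}+a)$. *Forests.* Let $\mathcal N=\{m-e_i : m\in\mathbb N^\nu,\ |m|\ge2,\ i\in[\nu]\}\subset\mathbb Z^\nu$. Let $\mathcal F(\mathcal N)$ be the set of finite (non-planar) rooted forests with vertices decorated by $\mathcal N$, up to isomorphism, including the empty forest $\emptyset$, and $\mathcal T(\mathcal N)$ the subset of trees; $\mathcal F(\mathcal N)$ is the free commutative monoid on $\mathcal T(\mathcal N)$. Denote by $n\triangleleft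 F$ the tree obtained by attaching a root decorated by $n$ to $F$. For a forest $F$ with vertex set $V_F$, let $\|F\|\in\mathbb Z^\nu$ be the sum of its decorations, and for $\sigma\in V_F$ let $\hat\sigma=\|\mathrm{Tree}(\sigma,F)\|$, where $\mathrm{Tree}(\sigma,F)$ is the subtree of $F$ rooted at $\sigma$. Let $\mathcal F^+(\mathcal N)$ be the set of forests $F$ such that $\hat\sigma\in\mathcal N$ for all $\sigma\in V_F$ (so $\emptyset\in\mathcal F^+(\mathcal N)$), and define $$S^F(q)=\prod_{\sigma\in V_F}\frac1{q^{\hat\sigma}-1}\ \text{ if } F\in\mathcal F^+(\mathcal N),\qquad S^F(q)=0\ \text{ otherwise.}$$ *Operators.* Write $a_i=\sum_{n\in\mathcal N}a_{i,n}z^{n+e_i}$ (with $a_{i,n}=0$ if $n+e_i\notin\mathbb N^\nu$) and $\partial_i=\partial/\partial z_i$. Let $(D_F(a))_{F\in\mathcal F(\mathcal N)}$, written $D_F$, be the unique family of linear endomorphisms of $\mathbb C[[z_1,\dots,z_\nu]]$ such that 1. $D_\emptyset=\mathrm{Id}$; 2. $D_{n\triangleleft F}=\sum_{i=1}^\nu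 D_F(a_{i,n}z^{n+e_i})\,\partial_i$ for $n\in\mathcal N$, $F\in\mathcal F(\mathcal N)$; 3. $D_{U_1\cdots U_d}=\frac1{d_1!\cdots d_r!}\sum_{i\in[\nu]^d}(D_{U_1}z_{i_1})\cdots(D_{U_d}z_{i_d})\,\partial_{i_1}\cdots\partial_{i_d}$ for $d\ge1$ and trees $U_1,\dots,U_d$, where $d_1,\dots,d_r$ are the multiplicities of the distinct trees in this list. A family of formal series is *formally summable* if for every $k\in\mathbb N$ only finitely many of its members have total order $\le k$; its sum is then taken coefficientwise. **Theorem.** No denominator in the definition of $S^F(q)$ vanishes, and $S^\bullet(q)$ is separative: $S^\emptyset(q)=1$ and $S^{U_1\cdots U_d}(q)=S^{U_1}(q)\cdots S^{U_d}(q)$ for all $d\ge1$ and all trees $U_1,\dots,U_d$. There is a unique $\nu$-tuple $h=(h_1,\dots,h_\nu)$ of formal series such that every $h_i-z_i$ has total order $\ge2$ and $g\circ h=h\circ R_q$. For every $\varphi\in\mathbb C[[z_1,\dots,z_\nu]]$ the family $(S^F(q)\,D_F(a)\varphi)_{F\in\mathcal F(\mathcal N)}$ is formally summable and $$\varphi\circ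 h=\sum_{F\in\mathcal F(\mathcal N)}S^F(q)\,D_F(a)\varphi,$$ that is, the composition operator of $h$ is $C_h=\sum_F S^F(q)\,D_F(a)$. Moreover, for every $i\in[\nu]$, $$h_i(z)=z_i+\sum_{T\in\mathcal T(\mathcal N)\cap\mathcal F^+(\mathcal N)}\Bigl(\prod_{\sigma\in V_T}\frac1{q^{\hat\sigma}-1}\Bigr)D_T z_i,$$ the sum being formally summable. -/

import Mathlib

noncomputable section

namespace TreeExpansion

/-! ### Decorated forests and trees -/

/-- Planar (ordered) `α`-decorated rooted forests: either the empty forest, or a first tree, with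
root decoration `n` and forest of children `A`, followed by the remaining trees `R`. -/
inductive PlanarForest (α : Type*) : Type _
  | nil : PlanarForest α
  | cons (n : α) (A R : PlanarForest α) : PlanarForest α

/-- Elementary reordering of a planar forest: exchange two adjacent sibling trees, at any place
(among the roots, or among the children of some vertex). -/
inductive PlanarForest.Swap {α : Type*} : PlanarForest α → PlanarForest α → Prop
  | swap (n m : α) (A B R : PlanarForest α) :
      Swap (cons n A (cons m B R)) (cons m B (cons n A R))
  | child (n : α) {A A' : PlanarForest α} (R : PlanarForest α) :
      Swap A A' → Swap (cons n A R) (cons n A' R)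
  | tail (n : α) (A : PlanarForest α) {R R' : PlanarForest α} :
      Swap R R' → Swap (cons n A R) (cons n A R')

/-- `α`-forests: isomorphism classes of finite `α`-decorated rooted forests, i.e. planar forests
up to reordering of siblings. -/
def Forest (α : Type*) : Type _ := Quot (PlanarForest.Swap (α := α))

/-- `α`-trees.  The pair `(n, F)` is the tree obtained by attaching a root with decoration `n` to
the forest `F`. -/
abbrev Tree (α : Type*) : Type _ := α × Forest α

namespace Forest

variable {α : Type*}

/-- The empty forest. -/
def empty : Forest α := Quot.mk _ PlanarForest.nil

/-- The forest `T · F` obtained by adding the tree `T` to the forest `F`. -/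
def cons (T : Tree α) (F : Forest α) : Forest α :=
  Quot.liftOn₂ T.2 F (fun A R => Quot.mk _ (PlanarForest.cons T.1 A R))
    (fun A _ _ h => Quot.sound (.tail T.1 A h)) (fun _ _ R h => Quot.sound (.child T.1 R h))

/-- A tree, seen as a forest. -/
def single (T : Tree α) : Forest α := cons T empty

theorem cons_left_comm (T U : Tree α) (F : Forest α) :
    cons T (cons U F) = cons U (cons T F) := by
  obtain ⟨n, A⟩ := T
  obtain ⟨m, B⟩ := U
  induction A using Quot.ind with | _ A
  induction B using Quot.ind with | _ B
  induction F using Quot.ind with | _ F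
  exact Quot.sound (.swap n m A B F)

instance : LeftCommutative (cons (α := α)) := ⟨cons_left_comm⟩

/-- The product `U₁ ⋯ U_d` of the trees of a multiset. -/
def ofTrees (s : Multiset (Tree α)) : Forest α := s.foldr cons empty

/-- The multiset of the trees `U₁, …, U_d` such that `F = U₁ ⋯ U_d`. -/
def trees (F : Forest α) : Multiset (Tree α) :=
  Quot.liftOn F
    (fun P => PlanarForest.rec (motive := fun _ => Multiset (Tree α)) 0
      (fun n A _ _ t => (n, Quot.mk _ A) ::ₘ t) P)
    (fun P Q h => by
      induction h with
      | swap n m A B R => exact Multiset.cons_swap _ _ _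
      | child n R h _ => exact congrArg (fun B => (n, B) ::ₘ _) (Quot.sound h)
      | tail n A h ih => exact congrArg _ ih)

/-- The family of the trees `Tree(σ, F)` (the subtree of `F` rooted at `σ`), where `σ` runs over
the vertices of `F`. -/
def vertices (F : Forest α) : Multiset (Tree α) :=
  Quot.liftOn F
    (fun P => PlanarForest.rec (motive := fun _ => Multiset (Tree α)) 0
      (fun n A _ s t => (n, Quot.mk _ A) ::ₘ (s + t)) P)
    (fun P Q h => by
      induction h with
      | swap n m A B R =>
        change _ ::ₘ (_ + _ ::ₘ (_ + _)) = _ ::ₘ (_ + _ ::ₘ (_ + _))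
        rw [Multiset.add_cons, Multiset.add_cons, Multiset.cons_swap, add_left_comm]
      | child n R h ih => exact congrArg₂ (fun B s => (n, B) ::ₘ (s + _)) (Quot.sound h) ih
      | tail n A h ih => exact congrArg (fun t => _ ::ₘ (_ + t)) ih)

@[simp] theorem trees_empty : trees (empty : Forest α) = 0 := rfl

@[simp] theorem trees_cons (T : Tree α) (F : Forest α) : trees (cons T F) = T ::ₘ trees F := by
  obtain ⟨n, A⟩ := T
  induction A using Quot.ind with | _ A
  induction F using Quot.ind with | _ F
  rfl

@[simp] theorem vertices_empty : vertices (empty : Forest α) = 0 := rfl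

@[simp] theorem vertices_cons (T : Tree α) (F : Forest α) :
    vertices (cons T F) = T ::ₘ (vertices T.2 + vertices F) := by
  obtain ⟨n, A⟩ := T
  induction A using Quot.ind with | _ A
  induction F using Quot.ind with | _ F
  rfl

@[simp] theorem ofTrees_zero : ofTrees (0 : Multiset (Tree α)) = empty := rfl

@[simp] theorem ofTrees_cons (T : Tree α) (s : Multiset (Tree α)) :
    ofTrees (T ::ₘ s) = cons T (ofTrees s) := Multiset.foldr_cons _ _ _ _

theorem induction {p : Forest α → Prop} (empty : p empty)
    (cons : ∀ T F, p T.2 → p F → p (cons T F)) (F : Forest α) : p F := by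
  induction F using Quot.ind with | _ P
  induction P with
  | nil => exact empty
  | cons n A R hA hR => exact cons (n, Quot.mk _ A) (Quot.mk _ R) hA hR

@[simp] theorem trees_ofTrees (s : Multiset (Tree α)) : trees (ofTrees s) = s := by
  induction s using Multiset.induction with
  | empty => rfl
  | cons T s ih => simp [ih]

@[simp] theorem ofTrees_trees (F : Forest α) : ofTrees (trees F) = F := by
  induction F using Forest.induction with
  | empty => rfl
  | cons T F _ ih => simp [ih]

/-- Forests form the free commutative monoid on trees. -/
def equivMultiset : Forest α ≃ Multiset (Tree α) := ⟨trees, ofTrees, ofTrees_trees, trees_ofTrees⟩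

end Forest

open Classical in
/-- The product `d₁! ⋯ d_r!` of the factorials of the multiplicities of a multiset. -/
def multFactorial {β : Type*} (s : Multiset β) : ℕ := ∏ T ∈ s.toFinset, (s.count T).factorial

/-! ### Formal series and formal diffeomorphisms -/

/-- Formal power series `ℂ[[z₁, …, z_ν]]`. -/
abbrev Series (ν : ℕ) := MvPowerSeries (Fin ν) ℂ

/-- Operators: linear endomorphisms of `ℂ[[z₁, …, z_ν]]`. -/
abbrev Op (ν : ℕ) := Module.End ℂ (Series ν)

variable {ν : ℕ}

/-- The partial derivative `∂_i` as an operator. -/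
def partialOp (i : Fin ν) : Op ν := (MvPowerSeries.pderiv ℂ i).toLinearMap

/-- All the components have total order at least two. -/
def IsNonlinearPart (a : Fin ν → Series ν) : Prop := ∀ i, 2 ≤ (a i).order

/-- The identity `(z₁, …, z_ν)`. -/
def idTuple : Fin ν → Series ν := fun i => MvPowerSeries.X i

/-- Tangent-to-identity formal diffeomorphisms. -/
def IsTangentToId (h : Fin ν → Series ν) : Prop := IsNonlinearPart (h - idTuple)

/-- The diagonal linear map `R_q : z ↦ (q₁ z₁, …, q_ν z_ν)`. -/
def diagMap (q : Fin ν → ℂ) : Fin ν → Series ν := fun i => q i • MvPowerSeries.X i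

/-- Composition `u ∘ v` of tuples of series (used for `v` without constant term). -/
def comp (u v : Fin ν → Series ν) : Fin ν → Series ν := fun i => MvPowerSeries.subst v (u i)

/-- `q` is non-resonant: `q_i ≠ q^m` for all `i` and all `m ∈ ℕ^ν` with `|m| ≥ 2`. -/
def NonResonant (q : Fin ν → ℂ) : Prop :=
  ∀ (i : Fin ν) (m : Fin ν → ℕ), 2 ≤ ∑ j, m j → q i ≠ ∏ j, q j ^ m j

/-- A family of formal series is formally summable with sum `s`: for every `k`, only finitely many
members have total order `≤ k`, and the coefficients of `s` are the (finite) sums of the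
coefficients of the members. -/
def FormalHasSum {ι : Type*} (f : ι → Series ν) (s : Series ν) : Prop :=
  (∀ k : ℕ, {i | (f i).order ≤ k}.Finite) ∧
    ∀ m : Fin ν →₀ ℕ, MvPowerSeries.coeff m s = ∑ᶠ i, MvPowerSeries.coeff m (f i)

/-! ### The decoration set and the forests `𝓕⁺(𝓝)` -/

/-- `𝓝 = {m - e_i : m ∈ ℕ^ν, |m| ≥ 2, i ∈ [ν]} ⊆ ℤ^ν`. -/
def decorations (ν : ℕ) : Set (Fin ν → ℤ) :=
  {n | ∃ (m : Fin ν → ℕ) (i : Fin ν), 2 ≤ ∑ j, m j ∧ n = (fun j => (m j : ℤ)) - Pi.single i 1}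

/-- `𝓝`-forests. -/
abbrev NForest (ν : ℕ) := Forest (decorations ν)

/-- `𝓝`-trees. -/
abbrev NTree (ν : ℕ) := Tree (decorations ν)

/-- The weight `‖F‖`, the sum of the decorations of the vertices of `F`. -/
def weight (F : NForest ν) : Fin ν → ℤ := (F.vertices.map fun T => (T.1 : Fin ν → ℤ)).sum

/-- The set `𝓕⁺(𝓝)` of forests such that `σ̂ = ‖Tree(σ, F)‖ ∈ 𝓝` for all vertices `σ`. -/
def positiveForests (ν : ℕ) : Set (NForest ν) :=
  {F | ∀ T ∈ F.vertices, weight (Forest.single T) ∈ decorations ν}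

/-- `q^n = q₁^{n₁} ⋯ q_ν^{n_ν}` for `n ∈ ℤ^ν`. -/
def monomialPow (q : Fin ν → ℂ) (n : Fin ν → ℤ) : ℂ := ∏ j, q j ^ n j

/-- `∏_σ 1 / (q^σ̂ - 1)`, the product over the vertices `σ` of `F`. -/
def vertexProduct (q : Fin ν → ℂ) (F : NForest ν) : ℂ :=
  (F.vertices.map fun T => 1 / (monomialPow q (weight (Forest.single T)) - 1)).prod

open Classical in
/-- The armould `S^•(q)`. -/
def armouldS (q : Fin ν → ℂ) (F : NForest ν) : ℂ :=
  if F ∈ positiveForests ν then vertexProduct q F else 0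

/-- Separative armoulds: `A^∅ = 1` and `A^{U₁ ⋯ U_d} = A^{U₁} ⋯ A^{U_d}` for all `d ≥ 1` and all
trees `U₁, …, U_d`. -/
def IsSeparative (A : NForest ν → ℂ) : Prop :=
  A Forest.empty = 1 ∧ ∀ s : Multiset (NTree ν), s ≠ 0 →
    A (Forest.ofTrees s) = (s.map fun U => A (Forest.single U)).prod

/-! ### The coarmould associated with a nonlinear part -/

/-- The term `a_{i,n} z^{n+e_i}` of `a_i` (zero if `n + e_i` has a negative component). -/
def homTerm (a : Fin ν → Series ν) (i : Fin ν) (n : Fin ν → ℤ) : Series ν := by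
  classical
  exact fun m => if (fun j => (m j : ℤ)) = n + Pi.single i 1 then MvPowerSeries.coeff m (a i) else 0

/-- The rules (i) `D_∅ = Id`, (ii) `D_{n ◁ F} = ∑_i D_F(a_{i,n} z^{n+e_i}) ∂_i`, and
(iii) `D_{U₁ ⋯ U_d} = 1/(d₁! ⋯ d_r!) ∑_{i ∈ [ν]^d} (D_{U₁} z_{i₁}) ⋯ (D_{U_d} z_{i_d}) ∂_{i₁} ⋯ ∂_{i_d}`
for `d ≥ 1`, where `d₁, …, d_r` are the multiplicities of the distinct trees in `U₁, …, U_d`. -/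
structure IsCoarmouldOf (a : Fin ν → Series ν) (D : NForest ν → Op ν) : Prop where
  empty : D Forest.empty = LinearMap.id
  graft : ∀ (n : decorations ν) (F : NForest ν) (φ : Series ν),
    D (Forest.single (n, F)) φ = ∑ i, D F (homTerm a i n) * partialOp i φ
  prod : ∀ (d : ℕ), 1 ≤ d → ∀ (U : Fin d → NTree ν) (φ : Series ν),
    D (Forest.ofTrees (List.ofFn U : Multiset (NTree ν))) φ =
      (1 / (multFactorial (List.ofFn U : Multiset (NTree ν)) : ℂ)) •
        ∑ i : Fin d → Fin ν, (∏ k, D (Forest.single (U k)) (MvPowerSeries.X (i k))) *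
          (List.ofFn fun k => partialOp (i k)).prod φ

namespace Construction

variable (a : Fin ν → Series ν)

theorem partialOp_comm (i j : Fin ν) (φ : Series ν) :
    partialOp i (partialOp j φ) = partialOp j (partialOp i φ) := by
  rcases eq_or_ne i j with rfl | hij
  · rfl
  ext m
  simp only [partialOp, Derivation.coeFn_coe, MvPowerSeries.coeff_pderiv, Finsupp.add_apply, Finsupp.single_eq_of_ne hij,
    Finsupp.single_eq_of_ne hij.symm]
  rw [add_right_comm]
  push_cast
  ring

/-- The operator `d₁! ⋯ d_r! D_F` on planar forests. -/
def planarOp (P : PlanarForest (decorations ν)) : Op ν :=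
  PlanarForest.rec (motive := fun _ => Op ν) LinearMap.id
    (fun (n : decorations ν) A _ eA eR => ∑ i, (LinearMap.mulLeft ℂ
      ((1 / (multFactorial (Forest.trees (Quot.mk _ A)) : ℂ)) • eA (homTerm a i n))) ∘ₗ
        eR ∘ₗ partialOp i) P

theorem planarOp_cons (n : decorations ν) (A R : PlanarForest (decorations ν)) (φ : Series ν) :
    planarOp a (.cons n A R) φ = ∑ i, ((1 / (multFactorial (Forest.trees (Quot.mk _ A)) : ℂ)) •
      planarOp a A (homTerm a i n)) * planarOp a R (partialOp i φ) := by
  change (∑ i : Fin ν, _ : Op ν) φ = _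
  rw [LinearMap.sum_apply]
  rfl

theorem planarOp_swap {P Q : PlanarForest (decorations ν)} (h : PlanarForest.Swap P Q) :
    planarOp a P = planarOp a Q := by
  induction h with
  | swap n m A B R =>
    ext1 φ
    simp only [planarOp_cons, Finset.mul_sum]
    rw [Finset.sum_comm]
    refine Finset.sum_congr rfl fun i _ => Finset.sum_congr rfl fun j _ => ?_
    rw [partialOp_comm, mul_left_comm]
  | child n R h ih =>
    ext1 φ
    simp only [planarOp_cons, ih]
    rw [Quot.sound h]
  | tail n A h ih =>
    ext1 φ
    simp only [planarOp_cons, ih]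

/-- The operator `d₁! ⋯ d_r! D_F`. -/
def rawOp (F : NForest ν) : Op ν := Quot.liftOn F (planarOp a) fun _ _ h => planarOp_swap a h

theorem rawOp_empty : rawOp a Forest.empty = LinearMap.id := rfl

theorem rawOp_cons (T : NTree ν) (F : NForest ν) (φ : Series ν) :
    rawOp a (Forest.cons T F) φ = ∑ i, ((1 / (multFactorial T.2.trees : ℂ)) •
      rawOp a T.2 (homTerm a i T.1)) * rawOp a F (partialOp i φ) := by
  obtain ⟨n, A⟩ := T
  induction A using Quot.ind with | _ A
  induction F using Quot.ind with | _ F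
  exact planarOp_cons a n A F φ

/-- The operator `D_F`. -/
def op (F : NForest ν) : Op ν := (1 / (multFactorial F.trees : ℂ)) • rawOp a F

theorem op_single (T : NTree ν) (φ : Series ν) :
    op a (Forest.single T) φ = ∑ i, op a T.2 (homTerm a i T.1) * partialOp i φ := by
  have : multFactorial (Forest.single T).trees = 1 := by
    simp [Forest.single, multFactorial]
  rw [op, this, LinearMap.smul_apply, Forest.single, rawOp_cons]
  simp only [Nat.cast_one, div_one, one_smul]
  rfl

theorem op_single_X (T : NTree ν) (i : Fin ν) :
    op a (Forest.single T) (MvPowerSeries.X i) = op a T.2 (homTerm a i T.1) := by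
  rw [op_single, Finset.sum_eq_single i]
  · simp [partialOp]
  · intro j _ hj
    simp [partialOp, MvPowerSeries.pderiv_X_of_ne, hj.symm]
  · simp

theorem rawOp_ofTrees (d : ℕ) (U : Fin d → NTree ν) (φ : Series ν) :
    rawOp a (Forest.ofTrees (List.ofFn U : Multiset (NTree ν))) φ =
      ∑ i : Fin d → Fin ν, (∏ k, op a (Forest.single (U k)) (MvPowerSeries.X (i k))) *
          (List.ofFn fun k => partialOp (i k)).prod φ := by
  induction d generalizing φ with
  | zero => simp [rawOp_empty]
  | succ d ih =>
    rw [List.ofFn_succ, ← Multiset.cons_coe, Forest.ofTrees_cons, rawOp_cons,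
      ← (Fin.consEquiv fun _ => Fin ν).sum_comp, Fintype.sum_prod_type]
    refine Finset.sum_congr rfl fun j _ => ?_
    rw [ih, Finset.mul_sum]
    refine Finset.sum_congr rfl fun i _ => ?_
    have hc : Commute (partialOp j) (List.ofFn fun k => partialOp (i k)).prod := by
      refine Commute.list_prod_right _ _ fun x hx => ?_
      obtain ⟨k, rfl⟩ := (List.mem_ofFn' _ _).1 hx
      exact LinearMap.ext fun ψ => partialOp_comm _ _ ψ
    have hc' := LinearMap.congr_fun hc.eq φ
    simp only [Module.End.mul_apply] at hc'
    simp only [Fin.consEquiv_apply, Fin.prod_univ_succ, Fin.cons_zero, Fin.cons_succ,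
      List.ofFn_succ, List.prod_cons, Module.End.mul_apply, hc', op_single_X, mul_assoc]
    rfl

theorem isCoarmouldOf_op : IsCoarmouldOf a (op a) where
  empty := by
    have : multFactorial (Forest.empty : NForest ν).trees = 1 := by simp [multFactorial]
    rw [op, this, Nat.cast_one, div_one, one_smul]
    rfl
  graft n F φ := op_single a (n, F) φ
  prod d _ U φ := by
    rw [op, LinearMap.smul_apply, Forest.trees_ofTrees, rawOp_ofTrees]

end Construction

theorem IsCoarmouldOf.unique {a : Fin ν → Series ν} {D D' : NForest ν → Op ν}
    (hD : IsCoarmouldOf a D) (hD' : IsCoarmouldOf a D') : D = D' := by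
  have key : ∀ F : NForest ν, (∀ U ∈ F.trees, D (Forest.single U) = D' (Forest.single U)) →
      D F = D' F := by
    intro F h
    obtain ⟨l, hl⟩ := Quot.exists_rep F.trees
    have hl : (l : Multiset (NTree ν)) = F.trees := hl
    have hF : F = Forest.ofTrees (List.ofFn l.get : Multiset (NTree ν)) := by
      rw [List.ofFn_get, hl, Forest.ofTrees_trees]
    rcases Nat.eq_zero_or_pos l.length with h0 | h0
    · have : F = Forest.empty := by
        rw [← Forest.ofTrees_trees F, ← hl, List.length_eq_zero_iff.1 h0]; rfl
      rw [this, hD.empty, hD'.empty]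
    · ext1 φ
      have h' : ∀ k, D (Forest.single (l.get k)) = D' (Forest.single (l.get k)) := fun k =>
        h _ (by rw [← hl]; exact List.get_mem l k)
      rw [hF, hD.prod _ h0, hD'.prod _ h0]
      simp only [h']
  have key2 : ∀ F : NForest ν, ∀ U ∈ F.trees, D (Forest.single U) = D' (Forest.single U) := by
    intro F
    induction F using Forest.induction with
    | empty => simp
    | cons T F hT hF =>
      intro U hU
      rw [Forest.trees_cons, Multiset.mem_cons] at hU
      rcases hU with rfl | hU
      · ext1 φ
        obtain ⟨n, A⟩ := U
        rw [hD.graft, hD'.graft, key A hT]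
      · exact hF U hU
  exact funext fun F => key F (key2 F)

theorem existsUnique_isCoarmouldOf (a : Fin ν → Series ν) :
    ∃! D : NForest ν → Op ν, IsCoarmouldOf a D :=
  ⟨_, Construction.isCoarmouldOf_op a, fun _ h => h.unique (Construction.isCoarmouldOf_op a)⟩

/-- The coarmould `D_•(a)` associated with `a`: the unique family of operators satisfying the rules
(i), (ii), (iii). -/
def coarmould (a : Fin ν → Series ν) : NForest ν → Op ν := (existsUnique_isCoarmouldOf a).choose

theorem coarmould_spec (a : Fin ν → Series ν) : IsCoarmouldOf a (coarmould a) :=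
  (existsUnique_isCoarmouldOf a).choose_spec.1

end TreeExpansion

end

noncomputable section

namespace TreeExpansion

variable {ν : ℕ}

/-! ### Weights and degrees -/

/-! Put `C = ∑_F S^F D_F`. Every decoration has total degree at least one, `D_F` is homogeneous of
degree `‖F‖`, and only finitely many forests have weight of bounded total degree. Hence each
coefficient of `C φ` is a finite sum, and `C` never lowers orders. The armould `S` is multiplicative
on products of forests, while `D` obeys the Leibniz rule over splittings of a forest
(`coarmould_mul`). Multiplying out gives `C (φ ψ) = C φ · C ψ` (`forestSum_mul`). An algebra
endomorphism that does not lower orders is a substitution (`algHom_eq_subst`), so `C φ = φ ∘ h` with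
`h_i = C z_i`. The equation `g ∘ h = h ∘ R_q` says, coefficient by coefficient, that `(q^{m-e_i} -
1) [z^m] h_i = [z^m] (a_i ∘ h) = [z^m] C a_i`. Only the empty forest and trees act nontrivially on
`z_i`. For a tree `n ◁ G` of weight `m - e_i`, the left factor cancels the denominator at the root
and leaves `S^G D_G (a_{i,n} z^{n+e_i})`. Summing over `G` gives the right-hand side
(`mul_coeff_conjugacy`). Uniqueness is by induction on the degree: since `a` has order at least two,
the terms of `a ∘ h` of degree `k` depend only on the terms of `h` of lower degree, and
non-resonance determines the next ones. -/

@[simp] theorem weight_empty : weight (Forest.empty : NForest ν) = 0 := by simp [weight]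

@[simp] theorem weight_cons (T : NTree ν) (F : NForest ν) :
    weight (Forest.cons T F) = (T.1 : Fin ν → ℤ) + weight T.2 + weight F := by
  simp [weight, add_assoc]

theorem weight_single (T : NTree ν) :
    weight (Forest.single T) = (T.1 : Fin ν → ℤ) + weight T.2 := by
  simp [Forest.single]

/-- The total degree `n₁ + ⋯ + n_ν`. -/
def totalDeg (n : Fin ν → ℤ) : ℤ := ∑ j, n j

@[simp] theorem totalDeg_zero : totalDeg (0 : Fin ν → ℤ) = 0 := by simp [totalDeg]

@[simp] theorem totalDeg_add (n m : Fin ν → ℤ) : totalDeg (n + m) = totalDeg n + totalDeg m := by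
  simp [totalDeg, Finset.sum_add_distrib]

@[simp] theorem totalDeg_single (i : Fin ν) : totalDeg (Pi.single i 1 : Fin ν → ℤ) = 1 := by
  simp [totalDeg]

@[simp] theorem totalDeg_finsupp (m : Fin ν →₀ ℕ) :
    totalDeg (fun j => (m j : ℤ)) = (m.degree : ℤ) := by
  simp [totalDeg, Finsupp.degree_eq_sum]

theorem one_le_totalDeg {n : Fin ν → ℤ} (hn : n ∈ decorations ν) : 1 ≤ totalDeg n := by
  obtain ⟨m, i, hm, rfl⟩ := hn
  have : (2 : ℤ) ≤ ∑ j, (m j : ℤ) := by exact_mod_cast hm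
  have h1 : totalDeg ((fun j => (m j : ℤ)) - Pi.single i 1) = ∑ j, (m j : ℤ) - 1 := by
    simp [totalDeg]
  omega

theorem totalDeg_weight_nonneg (F : NForest ν) : 0 ≤ totalDeg (weight F) := by
  induction F using Forest.induction with
  | empty => simp
  | cons T F hT hF =>
    have := one_le_totalDeg T.1.2
    simp only [weight_cons, totalDeg_add]
    omega

theorem one_le_totalDeg_weight_cons (T : NTree ν) (F : NForest ν) :
    1 ≤ totalDeg (weight (Forest.cons T F)) := by
  have := one_le_totalDeg T.1.2
  have := totalDeg_weight_nonneg T.2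
  have := totalDeg_weight_nonneg F
  simp only [weight_cons, totalDeg_add]
  omega

theorem sub_single_mem_decorations (m : Fin ν →₀ ℕ) (hm : 2 ≤ m.degree) (i : Fin ν) :
    (fun j => (m j : ℤ)) - Pi.single i 1 ∈ decorations ν :=
  ⟨m, i, by rwa [← Finsupp.degree_eq_sum], rfl⟩

theorem finite_decorations_totalDeg_le (k : ℕ) :
    {n : decorations ν | totalDeg (n : Fin ν → ℤ) ≤ k}.Finite := by
  -- The total degree of `m - e_i` is `|m| - 1`, so the bound `k` forces every `m j ≤ k + 1`.
  have h : ((fun p : (Fin ν → ℕ) × Fin ν =>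
      ((fun j => (p.1 j : ℤ)) - Pi.single p.2 1 : Fin ν → ℤ)) ''
        (Set.Iic (fun _ => k + 1) ×ˢ Set.univ)).Finite :=
    ((Set.finite_Iic _).prod Set.finite_univ).image _
  refine Set.Finite.of_finite_image (f := Subtype.val) (h.subset ?_) Subtype.val_injective.injOn
  rintro _ ⟨⟨n, m, i, hm, rfl⟩, hn, rfl⟩
  refine ⟨(m, i), ⟨fun j => ?_, trivial⟩, rfl⟩
  have h1 : totalDeg ((fun j => (m j : ℤ)) - Pi.single i 1) = ∑ j, (m j : ℤ) - 1 := by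
    simp [totalDeg]
  have h2 : m j ≤ ∑ j, m j := Finset.single_le_sum (fun _ _ => Nat.zero_le _) (Finset.mem_univ j)
  have hn : totalDeg ((fun j => (m j : ℤ)) - Pi.single i 1) ≤ k := hn
  have h3 : ((∑ j, m j : ℕ) : ℤ) = ∑ j, (m j : ℤ) := by push_cast; rfl
  change m j ≤ k + 1
  omega

/-- A nonempty forest is a root decoration, the forest of its children and the remaining trees. The
root uses at least one unit of degree, so both smaller forests fall under the induction hypothesis.
-/
theorem finite_forests_totalDeg_le (k : ℕ) :
    {F : NForest ν | totalDeg (weight F) ≤ k}.Finite := by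
  induction k with
  | zero =>
    refine (Set.finite_singleton Forest.empty).subset fun F hF => ?_
    induction F using Forest.induction with
    | empty => rfl
    | cons T F _ _ =>
      have := one_le_totalDeg_weight_cons T F
      have hF : totalDeg (weight (Forest.cons T F)) ≤ (0 : ℕ) := hF
      omega
  | succ k ih =>
    refine ((Set.finite_singleton Forest.empty).union
      ((((finite_decorations_totalDeg_le (k + 1)).prod ih).prod ih).image
        fun p => Forest.cons p.1 p.2)).subset fun F hF => ?_
    induction F using Forest.induction with
    | empty => exact Or.inl rfl
    | cons T F _ _ =>
      have hF : totalDeg (weight (Forest.cons T F)) ≤ (k + 1 : ℕ) := hF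
      have h1 := one_le_totalDeg T.1.2
      have h2 := totalDeg_weight_nonneg T.2
      have h3 := totalDeg_weight_nonneg F
      simp only [weight_cons, totalDeg_add] at hF
      push_cast at hF
      refine Or.inr ⟨(T, F), ⟨⟨?_, ?_⟩, ?_⟩, rfl⟩
      · change totalDeg (T.1 : Fin ν → ℤ) ≤ (k + 1 : ℕ)
        push_cast
        omega
      · change totalDeg (weight T.2) ≤ k
        omega
      · change totalDeg (weight F) ≤ k
        omega

/-- The finite set of the forests whose weight has total degree at most `k`. -/
def forestsLE (ν k : ℕ) : Finset (NForest ν) := (finite_forests_totalDeg_le k).toFinset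

@[simp] theorem mem_forestsLE {k : ℕ} {F : NForest ν} :
    F ∈ forestsLE ν k ↔ totalDeg (weight F) ≤ k := by
  simp [forestsLE]

/-! ### Splittings of forests -/

/-- The product of two forests. -/
def Forest.mul {α : Type*} (F G : Forest α) : Forest α := ofTrees (F.trees + G.trees)

namespace Forest

variable {α : Type*}

@[simp] theorem trees_mul (F G : Forest α) : (mul F G).trees = F.trees + G.trees := by simp [mul]

theorem trees_injective : Function.Injective (trees (α := α)) := equivMultiset.injective

@[simp] theorem empty_mul (F : Forest α) : mul empty F = F := by simp [mul]

@[simp] theorem cons_mul (T : Tree α) (F G : Forest α) :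
    mul (cons T F) G = cons T (mul F G) := by simp [mul, ofTrees_cons]

theorem mul_comm (F G : Forest α) : mul F G = mul G F := by simp [mul, add_comm]

theorem cons_injective (T : Tree α) : Function.Injective (cons T) := fun F G h =>
  trees_injective (by simpa using congrArg trees h)

theorem exists_cons_of_mem {T : Tree α} {F : Forest α} (h : T ∈ F.trees) :
    ∃ G, F = cons T G := by
  obtain ⟨s, hs⟩ := Multiset.exists_cons_of_mem h
  exact ⟨ofTrees s, trees_injective (by simp [hs])⟩

open Classical in
/-- The finite set of the pairs `(G, H)` of forests with product `F`. -/
def splittings (F : Forest α) : Finset (Forest α × Forest α) :=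
  (F.trees.antidiagonal.map fun p => (ofTrees p.1, ofTrees p.2)).toFinset

@[simp] theorem mem_splittings {F : Forest α} {p : Forest α × Forest α} :
    p ∈ splittings F ↔ mul p.1 p.2 = F := by
  simp only [splittings, Multiset.mem_toFinset, Multiset.mem_map, Multiset.mem_antidiagonal]
  constructor
  · rintro ⟨s, hs, rfl⟩
    simp [mul, hs]
  · rintro rfl
    exact ⟨(p.1.trees, p.2.trees), by simp, by simp⟩

end Forest

@[simp] theorem weight_mul (F G : NForest ν) :
    weight (Forest.mul F G) = weight F + weight G := by
  induction F using Forest.induction with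
  | empty => simp
  | cons T F _ ih => simp [ih, add_assoc]

/-! ### The armould `S` -/

theorem empty_mem_positiveForests : (Forest.empty : NForest ν) ∈ positiveForests ν := by
  simp [positiveForests]

theorem cons_mem_positiveForests {T : NTree ν} {F : NForest ν} :
    Forest.cons T F ∈ positiveForests ν ↔
      weight (Forest.single T) ∈ decorations ν ∧ T.2 ∈ positiveForests ν ∧
        F ∈ positiveForests ν := by
  simp only [positiveForests, Set.mem_ofPred_eq, Forest.vertices_cons, Multiset.mem_cons,
    Multiset.mem_add, or_imp, forall_and, forall_eq]

theorem single_mem_positiveForests {T : NTree ν} :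
    Forest.single T ∈ positiveForests ν ↔
      weight (Forest.single T) ∈ decorations ν ∧ T.2 ∈ positiveForests ν := by
  conv_lhs => rw [Forest.single, cons_mem_positiveForests]
  simp [empty_mem_positiveForests]

@[simp] theorem vertexProduct_empty (q : Fin ν → ℂ) : vertexProduct q Forest.empty = 1 := by
  simp [vertexProduct]

theorem vertexProduct_cons (q : Fin ν → ℂ) (T : NTree ν) (F : NForest ν) :
    vertexProduct q (Forest.cons T F) =
      1 / (monomialPow q (weight (Forest.single T)) - 1) * vertexProduct q T.2 *
        vertexProduct q F := by
  simp [vertexProduct, mul_assoc]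

theorem vertexProduct_single (q : Fin ν → ℂ) (T : NTree ν) :
    vertexProduct q (Forest.single T) =
      1 / (monomialPow q (weight (Forest.single T)) - 1) * vertexProduct q T.2 := by
  conv_lhs => rw [Forest.single, vertexProduct_cons]
  simp

theorem armouldS_of_mem (q : Fin ν → ℂ) {F : NForest ν} (h : F ∈ positiveForests ν) :
    armouldS q F = vertexProduct q F := if_pos h

theorem armouldS_of_notMem (q : Fin ν → ℂ) {F : NForest ν} (h : F ∉ positiveForests ν) :
    armouldS q F = 0 := if_neg h

@[simp] theorem armouldS_empty (q : Fin ν → ℂ) : armouldS q Forest.empty = 1 := by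
  rw [armouldS_of_mem q empty_mem_positiveForests, vertexProduct_empty]

/-- Once the root condition holds, membership in `𝓕⁺(𝓝)` depends on the children alone, so the
recursion also covers the default value zero. -/
theorem armouldS_single (q : Fin ν → ℂ) (T : NTree ν)
    (hT : weight (Forest.single T) ∈ decorations ν) :
    armouldS q (Forest.single T) =
      1 / (monomialPow q (weight (Forest.single T)) - 1) * armouldS q T.2 := by
  by_cases h : T.2 ∈ positiveForests ν
  · rw [armouldS_of_mem q h, armouldS_of_mem q (single_mem_positiveForests.2 ⟨hT, h⟩),
      vertexProduct_single]
  · rw [armouldS_of_notMem q h,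
      armouldS_of_notMem q fun h' => h (single_mem_positiveForests.1 h').2, mul_zero]

theorem armouldS_cons (q : Fin ν → ℂ) (T : NTree ν) (F : NForest ν) :
    armouldS q (Forest.cons T F) = armouldS q (Forest.single T) * armouldS q F := by
  have h : Forest.cons T F ∈ positiveForests ν ↔
      Forest.single T ∈ positiveForests ν ∧ F ∈ positiveForests ν := by
    rw [cons_mem_positiveForests, single_mem_positiveForests, and_assoc]
  by_cases h1 : Forest.single T ∈ positiveForests ν
  · by_cases h2 : F ∈ positiveForests ν
    · rw [armouldS_of_mem q h1, armouldS_of_mem q h2, armouldS_of_mem q (h.2 ⟨h1, h2⟩),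
        vertexProduct_cons, vertexProduct_single]
    · rw [armouldS_of_notMem q h2, armouldS_of_notMem q fun h' => h2 (h.1 h').2, mul_zero]
  · rw [armouldS_of_notMem q h1, armouldS_of_notMem q fun h' => h1 (h.1 h').1, zero_mul]

theorem armouldS_mul (q : Fin ν → ℂ) (F G : NForest ν) :
    armouldS q (Forest.mul F G) = armouldS q F * armouldS q G := by
  induction F using Forest.induction with
  | empty => simp
  | cons T F _ ih => rw [Forest.cons_mul, armouldS_cons, ih, armouldS_cons q T F, mul_assoc]

theorem isSeparative_armouldS (q : Fin ν → ℂ) : IsSeparative (armouldS q) := by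
  refine ⟨armouldS_empty q, fun s hs => ?_⟩
  clear hs
  induction s using Multiset.induction with
  | empty => simp
  | cons T s ih => rw [Forest.ofTrees_cons, armouldS_cons, ih, Multiset.map_cons,
      Multiset.prod_cons]

theorem monomialPow_sub_single {q : Fin ν → ℂ} (hq0 : ∀ i, q i ≠ 0) (m : Fin ν → ℕ) (i : Fin ν) :
    monomialPow q ((fun j => (m j : ℤ)) - Pi.single i 1) = (∏ j, q j ^ m j) / q i := by
  simp only [monomialPow, Pi.sub_apply, zpow_sub₀ (hq0 _), Finset.prod_div_distrib, zpow_natCast]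
  congr 1
  rw [Finset.prod_eq_single i] <;> simp +contextual

/-- For `n = m - e_i`, `q^n = 1` would mean `q^m = q_i`, which is a resonance. -/
theorem monomialPow_sub_one_ne_zero {q : Fin ν → ℂ} (hq0 : ∀ i, q i ≠ 0) (hq : NonResonant q)
    {n : Fin ν → ℤ} (hn : n ∈ decorations ν) : monomialPow q n - 1 ≠ 0 := by
  obtain ⟨m, i, hm, rfl⟩ := hn
  rw [monomialPow_sub_single hq0, sub_ne_zero, Ne, div_eq_one_iff_eq (hq0 i)]
  exact (hq i m hm).symm

/-! ### The coarmould -/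

open Classical in
theorem multFactorial_cons {β : Type*} (T : β) (s : Multiset β) :
    multFactorial (T ::ₘ s) = (s.count T + 1) * multFactorial s := by
  have hsub : s.toFinset ⊆ insert T s.toFinset := Finset.subset_insert _ _
  have h1 : multFactorial s = ∏ U ∈ insert T s.toFinset, (s.count U).factorial := by
    simp only [multFactorial]
    refine Finset.prod_subset hsub fun U _ hU => ?_
    rw [Multiset.count_eq_zero.2 (by simpa using hU), Nat.factorial_zero]
  have h2 : multFactorial (T ::ₘ s) =
      ∏ U ∈ insert T s.toFinset, ((T ::ₘ s).count U).factorial := by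
    rw [← Multiset.toFinset_cons, multFactorial]
  rw [h1, h2, ← Finset.mul_prod_erase _ _ (Finset.mem_insert_self _ _),
    ← Finset.mul_prod_erase _ (fun U => (s.count U).factorial)
      (Finset.mem_insert_self T _), Multiset.count_cons_self, Nat.factorial_succ, mul_assoc]
  congr 2
  refine Finset.prod_congr rfl fun U hU => ?_
  rw [Multiset.count_cons_of_ne (Finset.ne_of_mem_erase hU)]

theorem multFactorial_ne_zero {β : Type*} (s : Multiset β) : multFactorial s ≠ 0 :=
  Finset.prod_ne_zero_iff.2 fun _ _ => Nat.factorial_ne_zero _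

theorem coarmould_eq_op (a : Fin ν → Series ν) : coarmould a = Construction.op a :=
  (coarmould_spec a).unique (Construction.isCoarmouldOf_op a)

theorem coarmould_empty (a : Fin ν → Series ν) (φ : Series ν) :
    coarmould a Forest.empty φ = φ := by
  rw [(coarmould_spec a).empty, LinearMap.id_apply]

theorem coarmould_single_X (a : Fin ν → Series ν) (T : NTree ν) (i : Fin ν) :
    coarmould a (Forest.single T) (MvPowerSeries.X i) = coarmould a T.2 (homTerm a i T.1) := by
  rw [coarmould_eq_op, Construction.op_single_X]

open Classical in
-- Rules (ii) and (iii) combined into a recursion that removes one tree at a time. Adding `T`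
-- multiplies the product of factorials by its new multiplicity, which is the factor on the left.
theorem coarmould_cons (a : Fin ν → Series ν) (T : NTree ν) (F : NForest ν) (φ : Series ν) :
    ((F.trees.count T + 1 : ℕ) : ℂ) • coarmould a (Forest.cons T F) φ =
      ∑ i, coarmould a T.2 (homTerm a i T.1) * coarmould a F (partialOp i φ) := by
  have h1 : ((F.trees.count T + 1 : ℕ) : ℂ) ≠ 0 := Nat.cast_ne_zero.2 (Nat.succ_ne_zero _)
  have h2 : (multFactorial F.trees : ℂ) ≠ 0 := Nat.cast_ne_zero.2 (multFactorial_ne_zero _)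
  simp only [coarmould_eq_op, Construction.op, LinearMap.smul_apply, Construction.rawOp_cons,
    Forest.trees_cons, multFactorial_cons, smul_smul, Finset.smul_sum]
  refine Finset.sum_congr rfl fun i _ => ?_
  rw [mul_smul_comm]
  congr 1
  rw [Nat.cast_mul]
  field_simp
  congr!

/-! ### Homogeneity of the operators `D_F`. -/

theorem coeff_homTerm (a : Fin ν → Series ν) (i : Fin ν) (n : Fin ν → ℤ) (m : Fin ν →₀ ℕ)
    [Decidable ((fun j => (m j : ℤ)) = n + Pi.single i 1)] :
    MvPowerSeries.coeff m (homTerm a i n) =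
      if (fun j => (m j : ℤ)) = n + Pi.single i 1 then MvPowerSeries.coeff m (a i) else 0 := by
  rw [MvPowerSeries.coeff_apply, homTerm]
  congr

theorem finsupp_cast_add (m m' : Fin ν →₀ ℕ) :
    (fun j => ((m + m') j : ℤ)) = (fun j => (m j : ℤ)) + fun j => (m' j : ℤ) := by
  ext j; simp

theorem finsupp_cast_single (i : Fin ν) :
    (fun j => ((Finsupp.single i 1 : Fin ν →₀ ℕ) j : ℤ)) = Pi.single i 1 := by
  classical
  ext j
  simp [Finsupp.single_apply, Pi.single_apply, eq_comm]

theorem exists_coeff_ne_zero_of_coeff_mul_ne_zero {φ ψ : Series ν} {m : Fin ν →₀ ℕ}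
    (h : MvPowerSeries.coeff m (φ * ψ) ≠ 0) :
    ∃ m₁ m₂, m₁ + m₂ = m ∧ MvPowerSeries.coeff m₁ φ ≠ 0 ∧ MvPowerSeries.coeff m₂ ψ ≠ 0 := by
  classical
  rw [MvPowerSeries.coeff_mul] at h
  obtain ⟨p, hp, hne⟩ := Finset.exists_ne_zero_of_sum_ne_zero h
  exact ⟨p.1, p.2, Finset.HasAntidiagonal.mem_antidiagonal.1 hp, left_ne_zero_of_mul hne,
    right_ne_zero_of_mul hne⟩

/-- The operator `D_F` is homogeneous of degree `‖F‖`. -/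
theorem exists_of_coeff_coarmould_ne_zero {a : Fin ν → Series ν} {F : NForest ν} {φ : Series ν}
    {m : Fin ν →₀ ℕ} (h : MvPowerSeries.coeff m (coarmould a F φ) ≠ 0) :
    ∃ m' : Fin ν →₀ ℕ, MvPowerSeries.coeff m' φ ≠ 0 ∧
      (fun j => (m j : ℤ)) = (fun j => (m' j : ℤ)) + weight F := by
  classical
  induction F using Forest.induction generalizing φ m with
  | empty => exact ⟨m, by rwa [coarmould_empty] at h, by simp⟩
  | cons T F hT hF =>
    have h' : MvPowerSeries.coeff m (∑ i, coarmould a T.2 (homTerm a i T.1) *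
        coarmould a F (partialOp i φ)) ≠ 0 := by
      rw [← coarmould_cons, map_smul]
      exact smul_ne_zero (Nat.cast_ne_zero.2 (Nat.succ_ne_zero _)) h
    rw [map_sum] at h'
    obtain ⟨i, -, hi⟩ := Finset.exists_ne_zero_of_sum_ne_zero h'
    obtain ⟨m₁, m₂, rfl, h1, h2⟩ := exists_coeff_ne_zero_of_coeff_mul_ne_zero hi
    obtain ⟨m₁', h1', h1''⟩ := hT h1
    obtain ⟨m₂', h2', h2''⟩ := hF h2
    rw [coeff_homTerm] at h1'
    have h1e := (ite_ne_right_iff.1 h1').1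
    rw [partialOp, Derivation.coeFn_coe, MvPowerSeries.coeff_pderiv] at h2'
    refine ⟨m₂' + Finsupp.single i 1, left_ne_zero_of_mul h2', ?_⟩
    rw [finsupp_cast_add, finsupp_cast_add, h1'', h2'', h1e, finsupp_cast_single, weight_cons]
    abel

theorem order_coarmould (a : Fin ν → Series ν) (F : NForest ν) (φ : Series ν) {k l : ℕ}
    (hF : (k : ℤ) ≤ totalDeg (weight F)) (hφ : l ≤ φ.order) :
    ((k + l : ℕ) : ℕ∞) ≤ (coarmould a F φ).order := by
  refine MvPowerSeries.nat_le_order fun m hm => ?_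
  by_contra h
  obtain ⟨m', h1, h2⟩ := exists_of_coeff_coarmould_ne_zero h
  have h3 := congrArg totalDeg h2
  rw [totalDeg_add, totalDeg_finsupp, totalDeg_finsupp] at h3
  have h4 : l ≤ m'.degree := by exact_mod_cast hφ.trans (MvPowerSeries.order_le h1)
  omega

theorem totalDeg_weight_le_of_coeff_ne_zero {a : Fin ν → Series ν} {F : NForest ν} {φ : Series ν}
    {m : Fin ν →₀ ℕ} (h : MvPowerSeries.coeff m (coarmould a F φ) ≠ 0) :
    totalDeg (weight F) ≤ m.degree := by
  obtain ⟨m', -, h2⟩ := exists_of_coeff_coarmould_ne_zero h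
  have h3 := congrArg totalDeg h2
  rw [totalDeg_add, totalDeg_finsupp, totalDeg_finsupp] at h3
  omega

/-- The map `(G, H) ↦ (T · G, H)` is a bijection from the splittings of `F` onto those splittings of
`T · F` whose first factor contains `T`; the other splittings are weighted by zero. -/
theorem sum_count_splittings {M : Type*} [AddCommGroup M] [Module ℂ M] [DecidableEq (NTree ν)]
    (T : NTree ν) (F : NForest ν) (f : NForest ν → NForest ν → M) :
    ∑ p ∈ (Forest.cons T F).splittings, (p.1.trees.count T : ℂ) • f p.1 p.2 =
      ∑ p ∈ F.splittings, ((p.1.trees.count T + 1 : ℕ) : ℂ) • f (Forest.cons T p.1) p.2 := by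
  symm
  refine Finset.sum_bij_ne_zero (fun p _ _ => (Forest.cons T p.1, p.2)) ?_ ?_ ?_ ?_
  · intro p hp _
    rw [Forest.mem_splittings] at hp ⊢
    rw [Forest.cons_mul, hp]
  · intro p _ _ p' _ _ h
    exact Prod.ext (Forest.cons_injective T (Prod.ext_iff.1 h).1) (Prod.ext_iff.1 h).2
  · rintro ⟨G, H⟩ hp hne
    have hc : G.trees.count T ≠ 0 := by
      intro h
      simp [h] at hne
    obtain ⟨G, rfl⟩ := Forest.exists_cons_of_mem (Multiset.count_ne_zero.1 hc)
    rw [Forest.mem_splittings, Forest.cons_mul] at hp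
    refine ⟨(G, H), Forest.mem_splittings.2 (Forest.cons_injective T hp), ?_, rfl⟩
    simpa using hne
  · intro p _ _
    simp

/-- Coseparativity of the coarmould. -/
theorem coarmould_mul (a : Fin ν → Series ν) (F : NForest ν) (φ ψ : Series ν) :
    coarmould a F (φ * ψ) = ∑ p ∈ F.splittings, coarmould a p.1 φ * coarmould a p.2 ψ := by
  classical
  induction F using Forest.induction generalizing φ ψ with
  | empty =>
    rw [Finset.sum_eq_single (Forest.empty, Forest.empty)]
    · simp [coarmould_empty]
    · rintro ⟨G, H⟩ h hne
      rw [Forest.mem_splittings] at h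
      have := congrArg Forest.trees h
      simp only [Forest.trees_mul, Forest.trees_empty, add_eq_zero] at this
      exact absurd (Prod.ext (Forest.trees_injective this.1) (Forest.trees_injective this.2)) hne
    · simp
  | cons T F _ ih =>
    have h0 : ((F.trees.count T + 1 : ℕ) : ℂ) ≠ 0 := Nat.cast_ne_zero.2 (Nat.succ_ne_zero _)
    -- Multiplying by the multiplicity of `T` in `T · F` makes the recursion `coarmould_cons`
    -- applicable.
    refine smul_right_injective _ h0 ?_
    change ((F.trees.count T + 1 : ℕ) : ℂ) • _ = ((F.trees.count T + 1 : ℕ) : ℂ) • _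
    have hswap : ∀ f : NForest ν → NForest ν → Series ν, ∀ G : NForest ν,
        ∑ p ∈ G.splittings, f p.1 p.2 = ∑ p ∈ G.splittings, f p.2 p.1 := fun f G =>
      Finset.sum_nbij' Prod.swap Prod.swap (by simp [Forest.mul_comm]) (by simp [Forest.mul_comm])
        (by simp) (by simp) (by simp)
    -- In a splitting, the multiplicity of `T` is the sum of its multiplicities in the two factors.
    -- Each of the resulting sums removes `T` from one factor, matching one term of the Leibniz rule
    -- for `∂_i`.
    have hsplit : ((F.trees.count T + 1 : ℕ) : ℂ) •
        ∑ p ∈ (Forest.cons T F).splittings, coarmould a p.1 φ * coarmould a p.2 ψ =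
        ∑ p ∈ (Forest.cons T F).splittings,
          (p.1.trees.count T : ℂ) • (coarmould a p.1 φ * coarmould a p.2 ψ) +
        ∑ p ∈ (Forest.cons T F).splittings,
          (p.1.trees.count T : ℂ) • (coarmould a p.2 φ * coarmould a p.1 ψ) := by
      rw [hswap (fun G H => (G.trees.count T : ℂ) • (coarmould a H φ * coarmould a G ψ)),
        ← Finset.sum_add_distrib, Finset.smul_sum]
      refine Finset.sum_congr rfl fun p hp => ?_
      rw [← add_smul]
      congr 1
      have := congrArg (fun G => Multiset.count T G.trees) (Forest.mem_splittings.1 hp)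
      simp only [Forest.trees_mul, Multiset.count_add, Forest.trees_cons,
        Multiset.count_cons_self] at this
      exact_mod_cast this.symm
    rw [hsplit, sum_count_splittings T F fun G H => coarmould a G φ * coarmould a H ψ,
      sum_count_splittings T F fun G H => coarmould a H φ * coarmould a G ψ, coarmould_cons,
      hswap (fun G H => ((G.trees.count T + 1 : ℕ) : ℂ) •
        (coarmould a H φ * coarmould a (Forest.cons T G) ψ)), ← Finset.sum_add_distrib]
    have hterm : ∀ p : NForest ν × NForest ν,
        ((p.1.trees.count T + 1 : ℕ) : ℂ) • (coarmould a (Forest.cons T p.1) φ * coarmould a p.2 ψ) +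
        ((p.2.trees.count T + 1 : ℕ) : ℂ) • (coarmould a p.1 φ * coarmould a (Forest.cons T p.2) ψ) =
        ∑ i, coarmould a T.2 (homTerm a i T.1) *
          (coarmould a p.1 (partialOp i φ) * coarmould a p.2 ψ +
            coarmould a p.1 φ * coarmould a p.2 (partialOp i ψ)) := by
      intro p
      rw [← smul_mul_assoc, ← mul_smul_comm, coarmould_cons, coarmould_cons, Finset.sum_mul,
        Finset.mul_sum, ← Finset.sum_add_distrib]
      exact Finset.sum_congr rfl fun i _ => by ring
    simp only [hterm]
    rw [Finset.sum_comm]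
    refine Finset.sum_congr rfl fun i _ => ?_
    have hL : partialOp i (φ * ψ) = partialOp i φ * ψ + φ * partialOp i ψ := by
      simp only [partialOp, Derivation.coeFn_coe, Derivation.leibniz, smul_eq_mul]
      ring
    rw [hL, map_add, ih, ih, ← Finset.sum_add_distrib, Finset.mul_sum]

/-! ### The sum over forests is a composition operator -/

/-- An algebra endomorphism of the ring of formal series that does not decrease orders is a
substitution operator. -/
theorem algHom_eq_subst (C : Series ν →ₐ[ℂ] Series ν)
    (hC : ∀ (k : ℕ) (φ : Series ν), k ≤ φ.order → k ≤ (C φ).order) (φ : Series ν) :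
    C φ = MvPowerSeries.subst (fun i => C (MvPowerSeries.X i)) φ := by
  have h1 : ∀ i, 1 ≤ (C (MvPowerSeries.X i)).order := fun i => by
    refine hC 1 _ ?_
    rw [Nat.cast_one, MvPowerSeries.one_le_order_iff_constCoeff_eq_zero,
      MvPowerSeries.constantCoeff_X]
  have hs : MvPowerSeries.HasSubst (fun i => C (MvPowerSeries.X i)) :=
    MvPowerSeries.hasSubst_of_constantCoeff_zero fun i =>
      MvPowerSeries.one_le_order_iff_constCoeff_eq_zero.1 (h1 i)
  have hpoly : ∀ p : MvPolynomial (Fin ν) ℂ,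
      C p = MvPowerSeries.subst (fun i => C (MvPowerSeries.X i)) (p : Series ν) := by
    intro p
    rw [MvPowerSeries.subst_coe]
    have : C.comp (MvPolynomial.coeToMvPowerSeries.algHom ℂ) =
        MvPolynomial.aeval (R := ℂ) fun i => C (MvPowerSeries.X i) := by
      refine MvPolynomial.algHom_ext fun i => ?_
      simp
    simpa using DFunLike.congr_fun this p
  ext m
  -- The series is a polynomial plus a remainder of order greater than `|m|`. Neither `C` nor the
  -- substitution lowers orders, so the remainder does not reach the coefficient at `m`.
  set p := MvPowerSeries.truncTotal (m.degree + 1) φ with hp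
  have hρ : ((m.degree + 1 : ℕ) : ℕ∞) ≤ (φ - p).order := by
    refine MvPowerSeries.nat_le_order fun d hd => ?_
    rw [map_sub, MvPolynomial.coeff_coe, hp, MvPowerSeries.coeff_truncTotal _ hd, sub_self]
  have hlt : (m.degree : ℕ∞) < (m.degree + 1 : ℕ) := by exact_mod_cast Nat.lt_succ_self _
  have e : φ = p + (φ - p) := by ring
  have hsub : ((m.degree + 1 : ℕ) : ℕ∞) ≤
      (MvPowerSeries.subst (fun i => C (MvPowerSeries.X i)) (φ - (p : Series ν))).order := by
    refine hρ.trans (le_trans ?_ (MvPowerSeries.le_order_subst hs _))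
    exact le_mul_of_one_le_left' (le_iInf h1)
  rw [e, map_add, MvPowerSeries.subst_add hs, hpoly, map_add, map_add,
    MvPowerSeries.coeff_of_lt_order (hlt.trans_le (hC _ _ hρ)),
    MvPowerSeries.coeff_of_lt_order (hlt.trans_le hsub)]

/-- The operator `∑_F S^F(q) D_F(a)`, as a linear map. -/
def forestSum (q : Fin ν → ℂ) (a : Fin ν → Series ν) : Op ν where
  toFun φ m := ∑ F ∈ forestsLE ν m.degree,
    armouldS q F * MvPowerSeries.coeff m (coarmould a F φ)
  map_add' φ ψ := by
    funext m
    simp only [map_add, mul_add, Finset.sum_add_distrib]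
    rfl
  map_smul' c φ := by
    funext m
    simp only [map_smul, smul_eq_mul, mul_left_comm _ c, ← Finset.mul_sum]
    rfl

/-- Forests of weight beyond `|m|` contribute nothing at `m`, so the cutoff may be enlarged; this
gives different coefficients a common range of summation. -/
theorem coeff_forestSum (q : Fin ν → ℂ) (a : Fin ν → Series ν) (φ : Series ν) (m : Fin ν →₀ ℕ)
    {k : ℕ} (hk : m.degree ≤ k) :
    MvPowerSeries.coeff m (forestSum q a φ) = ∑ F ∈ forestsLE ν k,
      armouldS q F * MvPowerSeries.coeff m (coarmould a F φ) := by
  refine Finset.sum_subset (fun F hF => ?_) fun F _ hF => ?_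
  · rw [mem_forestsLE] at hF ⊢
    omega
  · rw [mem_forestsLE] at hF
    by_contra h
    exact hF (totalDeg_weight_le_of_coeff_ne_zero (right_ne_zero_of_mul h))

theorem formalHasSum_forestSum (q : Fin ν → ℂ) (a : Fin ν → Series ν) (φ : Series ν) :
    FormalHasSum (fun F => armouldS q F • coarmould a F φ) (forestSum q a φ) := by
  refine ⟨fun k => (forestsLE ν k).finite_toSet.subset fun F hF => ?_, fun m => ?_⟩
  · rw [Finset.mem_coe, mem_forestsLE]
    by_contra h
    have h1 := order_coarmould a F φ (k := k + 1) (l := 0) (by push_cast; omega) (by simp)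
    have h2 : ((k + 1 + 0 : ℕ) : ℕ∞) ≤ k :=
      (h1.trans (MvPowerSeries.le_order_smul (a := armouldS q F))).trans hF
    have h3 : k + 1 + 0 ≤ k := by exact_mod_cast h2
    omega
  · rw [coeff_forestSum q a φ m le_rfl,
      finsum_eq_sum_of_support_subset (s := forestsLE ν m.degree)]
    · simp only [map_smul, smul_eq_mul]
    · intro F hF
      rw [Function.mem_support, map_smul, smul_eq_mul] at hF
      rw [Finset.mem_coe, mem_forestsLE]
      exact totalDeg_weight_le_of_coeff_ne_zero (right_ne_zero_of_mul hF)

theorem le_order_forestSum (q : Fin ν → ℂ) (a : Fin ν → Series ν) (φ : Series ν) (k : ℕ)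
    (hφ : k ≤ φ.order) : k ≤ (forestSum q a φ).order := by
  refine MvPowerSeries.nat_le_order fun m hm => ?_
  rw [coeff_forestSum q a φ m le_rfl]
  refine Finset.sum_eq_zero fun F _ => ?_
  rw [MvPowerSeries.coeff_of_lt_order, mul_zero]
  refine lt_of_lt_of_le ?_ (order_coarmould a F φ (k := 0)
    (by exact_mod_cast totalDeg_weight_nonneg F) hφ)
  exact_mod_cast (by omega : m.degree < 0 + k)

theorem coarmould_cons_eq_zero (a : Fin ν → Series ν) (T : NTree ν) (F : NForest ν) (φ : Series ν)
    (h : ∀ i, coarmould a F (partialOp i φ) = 0) : coarmould a (Forest.cons T F) φ = 0 := by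
  classical
  have h0 : ((F.trees.count T + 1 : ℕ) : ℂ) ≠ 0 := Nat.cast_ne_zero.2 (Nat.succ_ne_zero _)
  have h1 := coarmould_cons a T F φ
  rw [Finset.sum_eq_zero fun i _ => by rw [h, mul_zero]] at h1
  exact (smul_eq_zero.1 h1).resolve_left h0

theorem coarmould_cons_one (a : Fin ν → Series ν) (T : NTree ν) (F : NForest ν) :
    coarmould a (Forest.cons T F) 1 = 0 :=
  coarmould_cons_eq_zero a T F 1 fun i => by
    rw [partialOp, Derivation.coeFn_coe, MvPowerSeries.pderiv_one, map_zero]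

/-- A forest with at least two trees differentiates at least twice, which kills a coordinate. -/
theorem coarmould_cons_cons_X (a : Fin ν → Series ν) (T U : NTree ν) (F : NForest ν) (i : Fin ν) :
    coarmould a (Forest.cons T (Forest.cons U F)) (MvPowerSeries.X i) = 0 :=
  coarmould_cons_eq_zero a T _ _ fun j => by
    classical
    rw [partialOp, Derivation.coeFn_coe]
    rcases eq_or_ne i j with rfl | h
    · rw [MvPowerSeries.pderiv_X_self, coarmould_cons_one]
    · rw [MvPowerSeries.pderiv_X_of_ne h, map_zero]

theorem forestSum_one (q : Fin ν → ℂ) (a : Fin ν → Series ν) : forestSum q a 1 = 1 := by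
  ext m
  rw [coeff_forestSum q a 1 m le_rfl, Finset.sum_eq_single Forest.empty]
  · rw [armouldS_empty, one_mul, coarmould_empty]
  · intro F _ hF
    induction F using Forest.induction with
    | empty => exact absurd rfl hF
    | cons T F _ _ => rw [coarmould_cons_one, map_zero, mul_zero]
  · intro h
    simp at h

theorem forestSum_mul (q : Fin ν → ℂ) (a : Fin ν → Series ν) (φ ψ : Series ν) :
    forestSum q a (φ * ψ) = forestSum q a φ * forestSum q a ψ := by
  classical
  ext m
  have hR : MvPowerSeries.coeff m (forestSum q a φ * forestSum q a ψ) =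
      ∑ p ∈ forestsLE ν m.degree ×ˢ forestsLE ν m.degree, armouldS q (Forest.mul p.1 p.2) *
        MvPowerSeries.coeff m (coarmould a p.1 φ * coarmould a p.2 ψ) := by
    simp only [MvPowerSeries.coeff_mul, Finset.mul_sum]
    rw [Finset.sum_comm]
    refine Finset.sum_congr rfl fun x hx => ?_
    have hx := congrArg Finsupp.degree (Finset.HasAntidiagonal.mem_antidiagonal.1 hx)
    rw [map_add] at hx
    rw [coeff_forestSum q a φ x.1 (by omega : _ ≤ m.degree),
      coeff_forestSum q a ψ x.2 (by omega : _ ≤ m.degree), Finset.sum_mul_sum,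
      Finset.sum_product]
    refine Finset.sum_congr rfl fun F _ => Finset.sum_congr rfl fun G _ => ?_
    rw [armouldS_mul]
    ring
  have hL : MvPowerSeries.coeff m (forestSum q a (φ * ψ)) =
      ∑ x ∈ (forestsLE ν m.degree).sigma fun F => F.splittings,
        armouldS q (Forest.mul x.2.1 x.2.2) *
        MvPowerSeries.coeff m (coarmould a x.2.1 φ * coarmould a x.2.2 ψ) := by
    rw [coeff_forestSum q a _ m le_rfl, Finset.sum_sigma]
    refine Finset.sum_congr rfl fun F _ => ?_
    rw [coarmould_mul, map_sum, Finset.mul_sum]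
    exact Finset.sum_congr rfl fun p hp => by rw [Forest.mem_splittings.1 hp]
  rw [hL, hR]
  -- A pair `(G, H)` determines the forest `G · H` that it splits. The two cutoffs differ, since one
  -- bounds `‖G‖ + ‖H‖` and the other each weight separately, but the extra pairs have zero
  -- coefficient at `m`.
  refine Finset.sum_bij_ne_zero (fun x _ _ => x.2) ?_ ?_ ?_ fun _ _ _ => rfl
  · rintro ⟨F, G, H⟩ hx _
    rw [Finset.mem_sigma, Forest.mem_splittings, mem_forestsLE] at hx
    dsimp only at hx
    obtain ⟨hx, rfl⟩ := hx
    have h1 := totalDeg_weight_nonneg G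
    have h2 := totalDeg_weight_nonneg H
    rw [weight_mul, totalDeg_add] at hx
    rw [Finset.mem_product, mem_forestsLE, mem_forestsLE]
    dsimp only at *
    constructor <;> omega
  · rintro ⟨F, p⟩ hx _ ⟨F', p'⟩ hx' _ h
    rw [Finset.mem_sigma, Forest.mem_splittings] at hx hx'
    dsimp only at hx hx'
    obtain ⟨-, rfl⟩ := hx
    obtain ⟨-, rfl⟩ := hx'
    dsimp only at h
    rw [h]
  · rintro ⟨G, H⟩ _ hne
    refine ⟨⟨Forest.mul G H, (G, H)⟩, ?_, hne, rfl⟩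
    obtain ⟨m₁, m₂, h, h1, h2⟩ :=
      exists_coeff_ne_zero_of_coeff_mul_ne_zero (right_ne_zero_of_mul hne)
    have h1 := totalDeg_weight_le_of_coeff_ne_zero h1
    have h2 := totalDeg_weight_le_of_coeff_ne_zero h2
    have h := congrArg Finsupp.degree h
    rw [map_add] at h
    rw [Finset.mem_sigma, mem_forestsLE, Forest.mem_splittings, weight_mul, totalDeg_add]
    refine ⟨?_, rfl⟩
    dsimp only at *
    omega

/-- The components `h_i` of the solution of the conjugacy equation. -/
def conjugacy (q : Fin ν → ℂ) (a : Fin ν → Series ν) : Fin ν → Series ν :=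
  fun i => forestSum q a (MvPowerSeries.X i)

theorem forestSum_eq_subst (q : Fin ν → ℂ) (a : Fin ν → Series ν) (φ : Series ν) :
    forestSum q a φ = MvPowerSeries.subst (conjugacy q a) φ :=
  algHom_eq_subst (AlgHom.ofLinearMap (forestSum q a) (forestSum_one q a) (forestSum_mul q a))
    (fun k φ h => le_order_forestSum q a φ k h) φ

theorem formalHasSum_subst_conjugacy (q : Fin ν → ℂ) (a : Fin ν → Series ν) (φ : Series ν) :
    FormalHasSum (fun F => armouldS q F • coarmould a F φ)
      (MvPowerSeries.subst (conjugacy q a) φ) := by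
  rw [← forestSum_eq_subst]
  exact formalHasSum_forestSum q a φ

/-- Serves to pass from forests to trees: `x` is the empty forest, and the remaining omitted forests
contribute zero. -/
theorem FormalHasSum.comp_injective {ι κ : Type*} {f : κ → Series ν} {s : Series ν}
    (hf : FormalHasSum f s) {e : ι → κ} (he : Function.Injective e) {x : κ}
    (hx : x ∉ Set.range e) (h0 : ∀ y ∉ Set.range e, y ≠ x → f y = 0) :
    FormalHasSum (f ∘ e) (s - f x) := by
  refine ⟨fun k => Set.Finite.preimage (f := e) he.injOn (hf.1 k), fun m => ?_⟩
  have hfin : (Function.support fun y => MvPowerSeries.coeff m (f y)).Finite :=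
    (hf.1 m.degree).subset fun y hy => MvPowerSeries.order_le hy
  rw [map_sub, hf.2 m, sub_eq_iff_eq_add', ← finsum_mem_univ,
    finsum_mem_inter_support_eq' _ Set.univ (insert x (Set.range e)),
    finsum_mem_insert' _ hx (hfin.subset Set.inter_subset_right), finsum_mem_range he]
  · rfl
  · intro y hy
    refine ⟨fun _ => ?_, fun _ => trivial⟩
    by_contra h
    rw [Set.mem_insert_iff, not_or] at h
    exact hy (by simp only [h0 y h.2 h.1, map_zero])

theorem formalHasSum_conjugacy_sub_X (q : Fin ν → ℂ) (a : Fin ν → Series ν) (i : Fin ν) :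
    FormalHasSum
      (fun T : {T : NTree ν // Forest.single T ∈ positiveForests ν} =>
        vertexProduct q (Forest.single T.1) •
          coarmould a (Forest.single T.1) (MvPowerSeries.X i))
      (conjugacy q a i - MvPowerSeries.X i) := by
  have hinj : Function.Injective
      fun T : {T : NTree ν // Forest.single T ∈ positiveForests ν} => Forest.single T.1 := by
    intro T U h
    have := congrArg Forest.trees h
    exact Subtype.ext (by simpa [Forest.single] using this)
  have h := (formalHasSum_forestSum q a (MvPowerSeries.X i)).comp_injective hinj
    (x := Forest.empty) ?_ ?_
  · rw [armouldS_empty, one_smul, coarmould_empty] at h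
    refine (congrArg₂ FormalHasSum (funext fun T => ?_) rfl).mp h
    rw [Function.comp_apply, armouldS_of_mem q T.2]
  · rintro ⟨T, h⟩
    simpa [Forest.single] using congrArg Forest.trees h
  · intro F hF hne
    induction F using Forest.induction with
    | empty => exact absurd rfl hne
    | cons T F _ _ =>
      induction F using Forest.induction with
      | empty =>
        have hT : armouldS q (Forest.cons T Forest.empty) = 0 :=
          armouldS_of_notMem q fun h => hF ⟨⟨T, h⟩, rfl⟩
        rw [hT, zero_smul]
      | cons U F _ _ => rw [coarmould_cons_cons_X, smul_zero]

/-! ### The conjugacy equation -/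

/-- By homogeneity only the monomial of `a i` with exponent `m - ‖F‖ = n + e_i` can reach `z^m`. -/
theorem coeff_coarmould_homTerm (a : Fin ν → Series ν) (i : Fin ν) (F : NForest ν)
    (n : Fin ν → ℤ) (m : Fin ν →₀ ℕ)
    (hn : n + weight F + Pi.single i 1 = fun j => (m j : ℤ)) :
    MvPowerSeries.coeff m (coarmould a F (homTerm a i n)) =
      MvPowerSeries.coeff m (coarmould a F (a i)) := by
  classical
  rw [← sub_eq_zero, ← map_sub, ← map_sub]
  by_contra h
  obtain ⟨m', h1, h2⟩ := exists_of_coeff_coarmould_ne_zero h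
  refine h1 ?_
  rw [map_sub, coeff_homTerm, if_pos, sub_self]
  rw [← hn] at h2
  rw [← add_right_cancel_iff (a := weight F), ← h2]
  abel

/-- The core of the existence proof: multiplication by `q^{m-e_i} - 1` removes the root of every
contributing tree. -/
theorem mul_coeff_conjugacy {q : Fin ν → ℂ} (hq0 : ∀ i, q i ≠ 0) (hq : NonResonant q)
    {a : Fin ν → Series ν} (ha : IsNonlinearPart a) (i : Fin ν) (m : Fin ν →₀ ℕ)
    (hm : 2 ≤ m.degree) :
    (monomialPow q ((fun j => (m j : ℤ)) - Pi.single i 1) - 1) *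
      MvPowerSeries.coeff m (conjugacy q a i) =
        MvPowerSeries.coeff m (forestSum q a (a i)) := by
  classical
  have hd := sub_single_mem_decorations m hm i
  have hne := monomialPow_sub_one_ne_zero hq0 hq hd
  set N : Fin ν → ℤ := (fun j => (m j : ℤ)) - Pi.single i 1 with hN
  have hNm : N + Pi.single i 1 = fun j => (m j : ℤ) := sub_add_cancel _ _
  have hN1 : totalDeg N + 1 = m.degree := by
    rw [← totalDeg_single i, ← totalDeg_add, hNm, totalDeg_finsupp]
  rw [conjugacy, coeff_forestSum q a _ m le_rfl, coeff_forestSum q a _ m le_rfl, Finset.mul_sum]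
  -- If `G` contributes, `a i` contains a monomial with exponent `m' = m - ‖G‖` and `|m'| ≥ 2`, so
  -- the decoration `m' - e_i = N - ‖G‖` is admissible.
  have hmem : ∀ G : NForest ν, MvPowerSeries.coeff m (coarmould a G (a i)) ≠ 0 →
      N - weight G ∈ decorations ν := by
    intro G h
    obtain ⟨m', h1, h2⟩ := exists_of_coeff_coarmould_ne_zero h
    have h3 : 2 ≤ m'.degree := by exact_mod_cast (ha i).trans (MvPowerSeries.order_le h1)
    have h4 := sub_single_mem_decorations m' h3 i
    rwa [hN, h2, sub_right_comm, add_sub_cancel_right]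
  have hterm : ∀ (G : NForest ν) (n : decorations ν), (n : Fin ν → ℤ) + weight G = N →
      (monomialPow q N - 1) * (armouldS q (Forest.single (n, G)) *
        MvPowerSeries.coeff m (coarmould a (Forest.single (n, G)) (MvPowerSeries.X i))) =
      armouldS q G * MvPowerSeries.coeff m (coarmould a G (a i)) := by
    intro G n hn
    have hw : weight (Forest.single (n, G)) = N := by rw [weight_single, hn]
    rw [armouldS_single q _ (hw ▸ hd), hw, coarmould_single_X,
      coeff_coarmould_homTerm a i G n m (by rw [hn, hNm])]
    field_simp
  symm
  -- The weight of the tree must be `N`, so `G` determines the decoration of the root grafted onto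
  -- it.
  refine Finset.sum_bij_ne_zero
    (fun G _ h => Forest.single (⟨N - weight G, hmem G (right_ne_zero_of_mul h)⟩, G)) ?_ ?_ ?_ ?_
  · intro G _ h
    rw [mem_forestsLE, weight_single]
    dsimp only
    rw [sub_add_cancel]
    omega
  · intro G _ _ G' _ _ h
    have := congrArg Forest.trees h
    simp only [Forest.single, Forest.trees_cons, Forest.trees_empty, Multiset.cons_inj_left,
      Prod.mk.injEq] at this
    exact this.2
  · intro F hF h
    have h0 : MvPowerSeries.coeff m (coarmould a F (MvPowerSeries.X i)) ≠ 0 :=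
      right_ne_zero_of_mul (right_ne_zero_of_mul h)
    induction F using Forest.induction with
    | empty =>
      -- The empty forest contributes only at `m = e_i`, of degree one.
      rw [coarmould_empty, MvPowerSeries.coeff_X] at h0
      rw [(ite_ne_right_iff.1 h0).1, Finsupp.degree_single] at hm
      omega
    | cons T F _ _ =>
      induction F using Forest.induction with
      | cons U F _ _ => rw [coarmould_cons_cons_X, map_zero] at h0; exact absurd rfl h0
      | empty =>
        obtain ⟨n, G⟩ := T
        have hn : (n : Fin ν → ℤ) + weight G = N := by
          obtain ⟨m', h1, h2⟩ := exists_of_coeff_coarmould_ne_zero h0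
          rw [MvPowerSeries.coeff_X] at h1
          rw [hN, h2, (ite_ne_right_iff.1 h1).1, finsupp_cast_single, weight_cons, weight_empty]
          abel
        have hn' : (n : Fin ν → ℤ) = N - weight G := by rw [← hn, add_sub_cancel_right]
        refine ⟨G, ?_, ?_, ?_⟩
        · have := one_le_totalDeg n.2
          rw [mem_forestsLE]
          rw [← hn, totalDeg_add] at hN1
          omega
        · rw [← hterm G n hn]
          exact h
        · rw [Forest.single]
          congr 2
          exact Subtype.ext hn'.symm
  · intro G _ h
    exact (hterm G ⟨N - weight G, _⟩ (sub_add_cancel _ _)).symm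

/-! ### Tangent-to-identity tuples and the equation in coefficients. -/

theorem coeff_eq_of_isTangentToId {h : Fin ν → Series ν} (hh : IsTangentToId h) (i : Fin ν)
    {m : Fin ν →₀ ℕ} (hm : m.degree < 2) :
    MvPowerSeries.coeff m (h i) = MvPowerSeries.coeff m (MvPowerSeries.X i) := by
  rw [← sub_eq_zero, ← map_sub]
  exact MvPowerSeries.coeff_of_lt_order (lt_of_lt_of_le (by exact_mod_cast hm) (hh i))

theorem IsTangentToId.constantCoeff {h : Fin ν → Series ν} (hh : IsTangentToId h) (i : Fin ν) :
    MvPowerSeries.constantCoeff (h i) = 0 := by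
  rw [← MvPowerSeries.coeff_zero_eq_constantCoeff_apply,
    coeff_eq_of_isTangentToId hh i (by simp), MvPowerSeries.coeff_zero_X]

theorem IsTangentToId.hasSubst {h : Fin ν → Series ν} (hh : IsTangentToId h) :
    MvPowerSeries.HasSubst h :=
  MvPowerSeries.hasSubst_of_constantCoeff_zero hh.constantCoeff

theorem isTangentToId_add {a : Fin ν → Series ν} (ha : IsNonlinearPart a) :
    IsTangentToId (idTuple + a) := by
  rwa [IsTangentToId, add_sub_cancel_left]

/-- A nonempty forest raises the order by at least one, so below degree two only the empty forest
acts on a coordinate. -/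
theorem isTangentToId_conjugacy (q : Fin ν → ℂ) (a : Fin ν → Series ν) :
    IsTangentToId (conjugacy q a) := by
  intro i
  refine MvPowerSeries.nat_le_order fun m hm => ?_
  rw [Pi.sub_apply, idTuple, map_sub, sub_eq_zero, conjugacy, coeff_forestSum q a _ m le_rfl,
    Finset.sum_eq_single Forest.empty]
  · rw [armouldS_empty, one_mul, coarmould_empty]
  · intro F _ hF
    induction F using Forest.induction with
    | empty => exact absurd rfl hF
    | cons T F _ _ =>
      rw [MvPowerSeries.coeff_of_lt_order, mul_zero]
      refine lt_of_lt_of_le ?_ (order_coarmould a _ _ (k := 1) (l := 1)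
        (one_le_totalDeg_weight_cons T F) ?_)
      · exact_mod_cast hm
      · rw [Nat.cast_one, MvPowerSeries.one_le_order_iff_constCoeff_eq_zero,
          MvPowerSeries.constantCoeff_X]
  · intro h
    simp at h

/-- The conjugacy equation in terms of coefficients. -/
theorem conjugacy_equation_iff (q : Fin ν → ℂ) {a : Fin ν → Series ν} (ha : IsNonlinearPart a)
    {h : Fin ν → Series ν} (hh : IsTangentToId h) :
    comp (comp (diagMap q) (idTuple + a)) h = comp h (diagMap q) ↔
      ∀ i m, q i * (MvPowerSeries.coeff m (h i) +
          MvPowerSeries.coeff m (MvPowerSeries.subst h (a i))) =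
        (∏ j, q j ^ m j) * MvPowerSeries.coeff m (h i) := by
  have h1 : ∀ i, comp (comp (diagMap q) (idTuple + a)) h i =
      q i • (h i + MvPowerSeries.subst h (a i)) := by
    intro i
    rw [comp, comp, diagMap, MvPowerSeries.subst_smul (isTangentToId_add ha).hasSubst,
      MvPowerSeries.subst_X (isTangentToId_add ha).hasSubst, MvPowerSeries.subst_smul hh.hasSubst,
      Pi.add_apply, MvPowerSeries.subst_add hh.hasSubst, idTuple,
      MvPowerSeries.subst_X hh.hasSubst]
  have h2 : ∀ i, comp h (diagMap q) i = MvPowerSeries.rescale q (h i) := by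
    intro i
    rw [MvPowerSeries.rescale_eq_subst]
    rfl
  rw [funext_iff]
  refine forall_congr' fun i => ?_
  rw [h1, h2, MvPowerSeries.ext_iff]
  refine forall_congr' fun m => ?_
  rw [MvPowerSeries.coeff_rescale, map_smul, map_add, smul_eq_mul, Finsupp.prod_fintype _ _
    fun _ => pow_zero _]

theorem coeff_subst_of_degree_lt_two {h : Fin ν → Series ν} (hh : IsTangentToId h) {φ : Series ν}
    (hφ : 2 ≤ φ.order) {m : Fin ν →₀ ℕ} (hm : m.degree < 2) :
    MvPowerSeries.coeff m (MvPowerSeries.subst h φ) = 0 := by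
  refine MvPowerSeries.coeff_of_lt_order (lt_of_lt_of_le (b := 2) (by exact_mod_cast hm) ?_)
  refine hφ.trans (le_trans ?_ (MvPowerSeries.le_order_subst hh.hasSubst φ))
  exact le_mul_of_one_le_left' (le_iInf fun i =>
    MvPowerSeries.one_le_order_iff_constCoeff_eq_zero.2 (hh.constantCoeff i))

theorem conjugacy_equation {q : Fin ν → ℂ} (hq0 : ∀ i, q i ≠ 0) (hq : NonResonant q)
    {a : Fin ν → Series ν} (ha : IsNonlinearPart a) :
    comp (comp (diagMap q) (idTuple + a)) (conjugacy q a) = comp (conjugacy q a) (diagMap q) := by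
  classical
  have hh := isTangentToId_conjugacy q a
  refine (conjugacy_equation_iff q ha hh).2 fun i m => ?_
  rcases lt_or_ge m.degree 2 with hm | hm
  · rw [coeff_subst_of_degree_lt_two hh (ha i) hm, add_zero, coeff_eq_of_isTangentToId hh i hm,
      MvPowerSeries.coeff_X]
    split_ifs with hmi
    · rw [hmi, Finset.prod_eq_single i]
      · simp
      · intro j _ hj
        rw [Finsupp.single_eq_of_ne hj, pow_zero]
      · simp
    · simp
  -- Here `a_i ∘ h` becomes `C a_i`, to which the removal of roots applies.
  · rw [← forestSum_eq_subst, ← mul_coeff_conjugacy hq0 hq ha i m hm,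
      monomialPow_sub_single hq0]
    field_simp [hq0 i]
    ring

/-! ### Uniqueness of the solution. -/

theorem le_order_prod_pow {h : Fin ν → Series ν} (hh : ∀ i, 1 ≤ (h i).order) (d : Fin ν →₀ ℕ) :
    (d.degree : ℕ∞) ≤ (d.prod fun i e => h i ^ e).order := by
  refine le_trans ?_ (MvPowerSeries.le_order_prod _ _)
  rw [Finsupp.degree_apply, Nat.cast_sum]
  refine Finset.sum_le_sum fun i _ => ?_
  exact MvPowerSeries.le_order_pow_of_constantCoeff_eq_zero _
    (MvPowerSeries.one_le_order_iff_constCoeff_eq_zero.1 (hh i))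

/-- Replacing one factor at a time trades a factor of order at least one for a difference of order
at least `k`. The order is thus at least `k + |d| - 1`; the `+ 1` on the right avoids the
subtraction. -/
theorem le_order_prod_pow_sub {h h' : Fin ν → Series ν} (hh : ∀ i, 1 ≤ (h i).order)
    (hh' : ∀ i, 1 ≤ (h' i).order) {k : ℕ} (hk : ∀ i, k ≤ (h i - h' i).order) (d : Fin ν →₀ ℕ) :
    ((k + d.degree : ℕ) : ℕ∞) ≤
      ((d.prod fun i e => h i ^ e) - d.prod fun i e => h' i ^ e).order + 1 := by
  induction hn : d.degree generalizing d with
  | zero =>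
    rw [Finsupp.degree_eq_zero_iff] at hn
    simp [hn]
  | succ n ih =>
    have hd : d ≠ 0 := by
      rintro rfl
      simp at hn
    obtain ⟨i, hi⟩ := Finsupp.ne_iff.1 hd
    obtain ⟨d', rfl⟩ : ∃ d', d = d' + Finsupp.single i 1 :=
      ⟨d - Finsupp.single i 1, (tsub_add_cancel_of_le
        (Finsupp.single_le_iff.2 (Nat.one_le_iff_ne_zero.2 hi))).symm⟩
    rw [map_add, Finsupp.degree_single, add_left_inj] at hn
    have hprod : ∀ f : Fin ν → Series ν, ((d' + Finsupp.single i 1).prod fun i e => f i ^ e) =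
        (d'.prod fun i e => f i ^ e) * f i := by
      intro f
      rw [Finsupp.prod_add_index' (fun _ => pow_zero _) (fun _ _ _ => pow_add _ _ _),
        Finsupp.prod_single_index (h := fun i e => f i ^ e) (pow_zero _), pow_one]
    rw [hprod, hprod]
    have e : ∀ x y u v : Series ν, x * u - y * v = (x - y) * u + y * (u - v) := by
      intros; ring
    rw [e]
    refine le_trans ?_ (add_le_add_left MvPowerSeries.min_order_le_add 1)
    rw [min_add]
    refine le_min ?_ ?_
    · refine le_trans ?_ (add_le_add_left MvPowerSeries.le_order_mul 1)
      rw [add_right_comm, ← add_assoc k n 1, Nat.cast_add _ 1, Nat.cast_one]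
      exact add_le_add (ih d' hn) (hh i)
    · refine le_trans ?_ (add_le_add_left MvPowerSeries.le_order_mul 1)
      rw [← add_assoc k n 1, add_comm k n, Nat.cast_add _ 1, Nat.cast_one, Nat.cast_add]
      have h1 := le_order_prod_pow hh' d'
      rw [hn] at h1
      exact add_le_add_left (add_le_add h1 (hk i)) 1

/-- Every monomial of `φ` has degree at least two, so the gain `|d| - 1` is at least one: agreement
of the tuples below degree `k` yields agreement of the substitutions up to degree `k` inclusive. -/
theorem coeff_subst_congr {h h' : Fin ν → Series ν} (hh : IsTangentToId h)
    (hh' : IsTangentToId h') {k : ℕ} (hk : ∀ i, k ≤ (h i - h' i).order) {φ : Series ν}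
    (hφ : 2 ≤ φ.order) {m : Fin ν →₀ ℕ} (hm : m.degree ≤ k) :
    MvPowerSeries.coeff m (MvPowerSeries.subst h φ) =
      MvPowerSeries.coeff m (MvPowerSeries.subst h' φ) := by
  rw [MvPowerSeries.coeff_subst hh.hasSubst, MvPowerSeries.coeff_subst hh'.hasSubst]
  refine finsum_congr fun d => ?_
  by_cases hd : MvPowerSeries.coeff d φ = 0
  · rw [hd, zero_smul, zero_smul]
  · have h2 : 2 ≤ d.degree := by exact_mod_cast hφ.trans (MvPowerSeries.order_le hd)
    congr 1
    rw [← sub_eq_zero, ← map_sub]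
    by_contra hne
    have h3 := le_order_prod_pow_sub
      (fun i => MvPowerSeries.one_le_order_iff_constCoeff_eq_zero.2 (hh.constantCoeff i))
      (fun i => MvPowerSeries.one_le_order_iff_constCoeff_eq_zero.2 (hh'.constantCoeff i)) hk d
    have h4 : k + d.degree ≤ m.degree + 1 := by
      exact_mod_cast h3.trans (add_le_add_left (MvPowerSeries.order_le hne) 1)
    omega

theorem eq_of_conjugacy_equation {q : Fin ν → ℂ} (hq : NonResonant q)
    {a : Fin ν → Series ν} (ha : IsNonlinearPart a) {h h' : Fin ν → Series ν}
    (hh : IsTangentToId h) (hh' : IsTangentToId h')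
    (he : comp (comp (diagMap q) (idTuple + a)) h = comp h (diagMap q))
    (he' : comp (comp (diagMap q) (idTuple + a)) h' = comp h' (diagMap q)) : h = h' := by
  rw [conjugacy_equation_iff q ha hh] at he
  rw [conjugacy_equation_iff q ha hh'] at he'
  have key : ∀ k : ℕ, ∀ i, k ≤ (h i - h' i).order := by
    intro k
    induction k with
    | zero => simp
    | succ k ih =>
      intro i
      refine MvPowerSeries.nat_le_order fun m hm => ?_
      rw [map_sub]
      rcases lt_or_ge m.degree 2 with h2 | h2
      · rw [coeff_eq_of_isTangentToId hh i h2, coeff_eq_of_isTangentToId hh' i h2, sub_self]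
      · have h3 := he i m
        rw [coeff_subst_congr hh hh' ih (ha i) (Nat.lt_succ_iff.1 hm)] at h3
        have h4 : q i - ∏ j, q j ^ m j ≠ 0 :=
          sub_ne_zero.2 (hq i m (by rwa [← Finsupp.degree_eq_sum]))
        -- The nonlinear terms now coincide, and subtracting the two equations leaves `q i - q^m`
        -- times the difference of the coefficients.
        refine (mul_eq_zero.1 ?_).resolve_left h4
        linear_combination h3 - he' i m
  funext i
  rw [← sub_eq_zero, ← MvPowerSeries.order_eq_top_iff]
  exact ENat.eq_top_iff_forall_ge.2 fun k => key k i

end TreeExpansion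

end

theorem mainTheorem3 (ν : ℕ) (hν : 1 ≤ ν) (q : Fin ν → ℂ) (hq0 : ∀ i, q i ≠ 0)
    (hq : TreeExpansion.NonResonant q) (a : Fin ν → TreeExpansion.Series ν)
    (ha : TreeExpansion.IsNonlinearPart a) :
    -- `S^•(q)` is well defined (no denominator vanishes) and separative
    (∀ F ∈ TreeExpansion.positiveForests ν, ∀ T ∈ F.vertices,
      TreeExpansion.monomialPow q (TreeExpansion.weight (TreeExpansion.Forest.single T)) - 1 ≠ 0) ∧
    TreeExpansion.IsSeparative (TreeExpansion.armouldS q) ∧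
    ∃ h : Fin ν → TreeExpansion.Series ν,
      -- `h` is the unique tangent-to-identity solution of `g ∘ h = h ∘ R_q`, `g = R_q ∘ (id + a)`
      (TreeExpansion.IsTangentToId h ∧
        TreeExpansion.comp
            (TreeExpansion.comp (TreeExpansion.diagMap q) (TreeExpansion.idTuple + a)) h =
          TreeExpansion.comp h (TreeExpansion.diagMap q)) ∧
      (∀ h' : Fin ν → TreeExpansion.Series ν, TreeExpansion.IsTangentToId h' →
        TreeExpansion.comp
            (TreeExpansion.comp (TreeExpansion.diagMap q) (TreeExpansion.idTuple + a)) h' =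
          TreeExpansion.comp h' (TreeExpansion.diagMap q) → h' = h) ∧
      -- `C_h = ∑_F S^F(q) D_F(a)`
      (∀ φ : TreeExpansion.Series ν,
        TreeExpansion.FormalHasSum
          (fun F : TreeExpansion.NForest ν =>
            TreeExpansion.armouldS q F • TreeExpansion.coarmould a F φ)
          (MvPowerSeries.subst h φ)) ∧
      -- `h_i = z_i + ∑_T (∏_σ 1 / (q^σ̂ - 1)) D_T z_i`, over the trees in `𝓕⁺(𝓝)`
      (∀ i : Fin ν,
        ∃ s : TreeExpansion.Series ν,
          TreeExpansion.FormalHasSum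
            (fun T : {T : TreeExpansion.NTree ν //
                TreeExpansion.Forest.single T ∈ TreeExpansion.positiveForests ν} =>
              TreeExpansion.vertexProduct q (TreeExpansion.Forest.single T.1) •
                TreeExpansion.coarmould a (TreeExpansion.Forest.single T.1) (MvPowerSeries.X i))
            s ∧
          h i = MvPowerSeries.X i + s) := by
  refine ⟨fun F hF T hT => TreeExpansion.monomialPow_sub_one_ne_zero hq0 hq (hF T hT),
    TreeExpansion.isSeparative_armouldS q, TreeExpansion.conjugacy q a,
    ⟨TreeExpansion.isTangentToId_conjugacy q a, TreeExpansion.conjugacy_equation hq0 hq ha⟩,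
    fun h' hh' he' => TreeExpansion.eq_of_conjugacy_equation hq ha hh'
      (TreeExpansion.isTangentToId_conjugacy q a) he' (TreeExpansion.conjugacy_equation hq0 hq ha),
    TreeExpansion.formalHasSum_subst_conjugacy q a,
    fun i => ⟨_, TreeExpansion.formalHasSum_conjugacy_sub_X q a i, ?_⟩⟩
  rw [add_sub_cancel]
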